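/- Let $n\ge 0$ and let $\mathcal A\subset\mathbb N^n$ be a finite set with $0\in\mathcal A$. For $f\in\mathbb C[x_1,\dots,x_n]$ and $u\in\mathbb C^n$, let $$\mathcal L_{f,u}(\lambda,x)=\bigl(f,\ \partial_1 f-\lambda(u_1-x_1),\ \dots,\ \partial_n f-\lambda(u_n-x_n)\bigr),$$ a system of $n+1$ polynomials in the $n+1$ variables $(\lambda,x_1,\dots,x_n)$. For $w\in\mathbb Z^{n+1}$ and a polynomial $g=\sum_{a\in\mathcal B}c_a z^a$ in $n+1$ variables with support $\mathcal B$ (so all $c_a\neq0$), let $g_w=\sum_{a\in\mathcal B_w}c_a z^a$, where $\mathcal B_w$ is the set of $a\in\mathcal B$ at which $a\mapsto w\cdot a$ attains its minimum over $\mathcal B$. The facial system $(\mathcal L_{f,u})_w$ is obtained by replacing each entry $g$ of $\mathcal L_{f,u}$ by $g_w$. Theorem 4.2. Suppose that $f$ is general given its support $\mathcal A$, and that $u\in\mathbb C^n$ is general. Then for every nonzero $w\in\mathbb Z^{n+1}$, the facial system $(\mathcal L_{f,u})_w$ has no solutions in $(\mathbb C^\times)^{n+1}$. Here "general" means lying outside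 a proper algebraic subvariety. That is, there is a proper algebraic subvariety $Z\subsetneq\mathbb C^{\mathcal A}$ such that for every $c\in\mathbb C^{\mathcal A}\smallsetminus Z$ the polynomial $f=\sum_{a\in\mathcal A}c_a x^a$ has support exactly $\mathcal A$, and there is a proper algebraic subvariety $Y_f\subsetneq\mathbb C^n$ such that for every $u\in\mathbb C^n\smallsetminus Y_f$ and every nonzero $w\in\mathbb Z^{n+1}$, the facial system $(\mathcal L_{f,u})_w$ has no solutions in $(\mathbb C^\times)^{n+1}$. -/

import Mathlib

namespace SparseED

/-- A (complex, affine) algebraic subvariety of `ℂ^σ`: the common zero set of a set of polynomials. -/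
def IsAlgebraicSubvariety {σ : Type*} (Z : Set (σ → ℂ)) : Prop :=
  ∃ S : Set (MvPolynomial σ ℂ), Z = {x | ∀ p ∈ S, MvPolynomial.eval x p = 0}

/-- `P` holds for general `x ∈ ℂ^σ`: it holds for all `x` in the complement of a proper algebraic
subvariety. For finite `σ`, such a complement is a dense (Zariski) open subset of `ℂ^σ`. -/
def HoldsForGeneral {σ : Type*} (P : (σ → ℂ) → Prop) : Prop :=
  ∃ Z : Set (σ → ℂ), IsAlgebraicSubvariety Z ∧ Z ≠ Set.univ ∧ ∀ x, x ∉ Z → P x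

/-- The polynomial `∑_{a ∈ A} c_a x^a` with coefficient vector `c ∈ ℂ^A`. -/
noncomputable def sparsePoly {n : ℕ} (A : Finset (Fin n →₀ ℕ)) (c : A → ℂ) :
    MvPolynomial (Fin n) ℂ :=
  ∑ a : A, MvPolynomial.monomial (a : Fin n →₀ ℕ) (c a)

/-- The value `w · a` of the weight `w` on the exponent `a`. -/
def weightAt {m : ℕ} (w : Fin m → ℤ) (a : Fin m →₀ ℕ) : ℤ :=
  ∑ i, w i * (a i : ℤ)

/-- The face `A_w` of `A` exposed by `w`: the elements of `A` at which `a ↦ w · a` attains its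
minimum over `A`. -/
def face {m : ℕ} (w : Fin m → ℤ) (A : Finset (Fin m →₀ ℕ)) : Finset (Fin m →₀ ℕ) :=
  A.filter fun a => ∀ b ∈ A, weightAt w a ≤ weightAt w b

/-- The restriction `g_w` of `g` to the face, exposed by `w`, of the support of `g`. -/
noncomputable def facialPart {m : ℕ} (w : Fin m → ℤ) (g : MvPolynomial (Fin m) ℂ) :
    MvPolynomial (Fin m) ℂ :=
  ∑ a ∈ face w g.support, MvPolynomial.monomial a (MvPolynomial.coeff a g)

/-- The facial system `G_w = ((g_1)_w, …, (g_k)_w)` of a system `G = (g_1, …, g_k)`. -/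
noncomputable def facialSystem {k m : ℕ} (w : Fin m → ℤ) (G : Fin k → MvPolynomial (Fin m) ℂ) :
    Fin k → MvPolynomial (Fin m) ℂ :=
  fun j => facialPart w (G j)

/-- The Lagrange multiplier equations `L_{f,u} = (f, ∂_1 f - λ (u_1 - x_1), …, ∂_n f - λ (u_n - x_n))`
in the variables `(λ, x_1, …, x_n)`. The variable `λ` has index `0`, and `x_i` has index `i.succ`. -/
noncomputable def lagrange {n : ℕ} (f : MvPolynomial (Fin n) ℂ) (u : Fin n → ℂ) :
    Fin (n + 1) → MvPolynomial (Fin (n + 1)) ℂ :=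
  Fin.cons (MvPolynomial.rename Fin.succ f) fun i =>
    MvPolynomial.rename Fin.succ (MvPolynomial.pderiv i f)
      - MvPolynomial.X 0 * (MvPolynomial.C (u i) - MvPolynomial.X i.succ)

/-- The system `G` has a solution in the algebraic torus `(ℂ^×)^m`. -/
def HasTorusSolution {k m : ℕ} (G : Fin k → MvPolynomial (Fin m) ℂ) : Prop :=
  ∃ z : Fin m → ℂ, (∀ i, z i ≠ 0) ∧ ∀ j, MvPolynomial.eval z (G j) = 0

end SparseED

namespace SparseED

open MvPolynomial

/-! Write `w = (w₀, v)` and let `h ≤ 0` be the minimum of `v · a` on `A`. A torus solution `(λ, x)`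
of the facial system is excluded in one of two ways.

If `w₀ ≤ h`, a negative `v i` would leave only the monomial `λ x_i` in an entry, so `v ≥ 0` and `h =
0`. For `w₀ < 0` the entries force `x = u`, so `f(u) = 0`. For `w₀ = 0`, setting the coordinates
with `v i ≠ 0` to zero gives a critical point on a coordinate hyperplane. General `u` avoids both.

If `w₀ > h`, the gradient of the initial form `f_v` at `x` is `-λ x_i` on a set `J` where `2 v_i = h
- w₀`, and zero elsewhere. Euler's formula then gives `∑_J x_i² = 0`, so `f_v = 0` and this quadric
are not transverse at `x`. General coefficients exclude this (`holdsForGeneral_transverse`). Only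
finitely many subsums and sets `J` occur, so one condition serves all `w`.

Both genericity statements are proved at algebraically independent parameters, using derivations
instead of Bertini or Sard arguments, and transferred by `holdsForGeneral_of_generic`. -/

theorem holdsForGeneral_iff {σ : Type*} {P : (σ → ℂ) → Prop} :
    HoldsForGeneral P ↔ ∃ p : MvPolynomial σ ℂ, p ≠ 0 ∧ ∀ x, eval x p ≠ 0 → P x := by
  constructor
  · rintro ⟨Z, ⟨S, rfl⟩, hZ, h⟩
    obtain ⟨x, hx⟩ := (Set.ne_univ_iff_exists_notMem _).1 hZ
    simp only [Set.mem_ofPred_eq, not_forall] at hx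
    obtain ⟨p, hp, hpx⟩ := hx
    refine ⟨p, fun h0 => hpx (by simp [h0]), fun y hy => h y fun hmem => hy (hmem p hp)⟩
  · rintro ⟨p, hp, h⟩
    refine ⟨{x | eval x p = 0}, ⟨{p}, by simp⟩, fun hu => hp ?_, fun x hx => h x hx⟩
    refine MvPolynomial.funext fun x => ?_
    have : x ∈ {x | eval x p = 0} := hu ▸ Set.mem_univ x
    simpa using this

theorem HoldsForGeneral.mono {σ : Type*} {P Q : (σ → ℂ) → Prop} (hP : HoldsForGeneral P)
    (h : ∀ x, P x → Q x) : HoldsForGeneral Q := by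
  obtain ⟨Z, hZ, hZ', hP⟩ := hP
  exact ⟨Z, hZ, hZ', fun x hx => h x (hP x hx)⟩

theorem HoldsForGeneral.forall {σ ι : Type*} [Finite ι] {P : ι → (σ → ℂ) → Prop}
    (h : ∀ i, HoldsForGeneral (P i)) : HoldsForGeneral fun x => ∀ i, P i x := by
  cases nonempty_fintype ι
  simp only [holdsForGeneral_iff] at h ⊢
  choose p hp h using h
  refine ⟨∏ i, p i, Finset.prod_ne_zero_iff.2 fun i _ => hp i, fun x hx i => h i x ?_⟩
  rw [map_prod] at hx
  exact Finset.prod_ne_zero_iff.1 hx i (Finset.mem_univ i)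

theorem HoldsForGeneral.and {σ : Type*} {P Q : (σ → ℂ) → Prop} (hP : HoldsForGeneral P)
    (hQ : HoldsForGeneral Q) : HoldsForGeneral fun x => P x ∧ Q x := by
  obtain ⟨p, hp, hP⟩ := holdsForGeneral_iff.1 hP
  obtain ⟨q, hq, hQ⟩ := holdsForGeneral_iff.1 hQ
  refine holdsForGeneral_iff.2 ⟨p * q, mul_ne_zero hp hq, fun x hx => ?_⟩
  rw [map_mul] at hx
  exact ⟨hP x (left_ne_zero_of_mul hx), hQ x (right_ne_zero_of_mul hx)⟩

/-! ### Derivations with prescribed values on algebraically independent elements. -/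

/-- In characteristic zero, a field is formally étale over the polynomial ring on a
transcendence basis. -/
theorem formallyEtale_of_isTranscendenceBasis {ι k K : Type*} [Field k] [CharZero k] [Field K]
    [Algebra k K] {v : ι → K} (hv : IsTranscendenceBasis k v) [Algebra (MvPolynomial ι k) K]
    (halg : algebraMap (MvPolynomial ι k) K = (aeval (R := k) v).toRingHom) :
    Algebra.FormallyEtale (MvPolynomial ι k) K := by
  open scoped IntermediateField.algebraAdjoinAdjoin in
  let A₀ := Algebra.adjoin k (Set.range v)
  let F := IntermediateField.adjoin k (Set.range v)
  -- The tower `A₀ → F → K` is a localization followed by an algebraic extension, separable in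
  -- characteristic zero.
  have : Algebra.FormallyEtale A₀ F := .of_isLocalization (nonZeroDivisors A₀)
  have : Algebra.IsAlgebraic F K := hv.isAlgebraic_field
  have : CharZero F := algebraRat.charZero F
  have : Algebra.FormallyEtale F K := .of_isSeparable F K
  have : Algebra.FormallyEtale A₀ K := .comp A₀ F K
  let e := hv.1.aevalEquiv
  let _ : Algebra (MvPolynomial ι k) A₀ := e.toRingHom.toAlgebra
  have : Algebra.FormallyEtale (MvPolynomial ι k) A₀ :=
    .of_equiv (A := MvPolynomial ι k) { e.toRingEquiv with commutes' := fun _ => rfl }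
  have : IsScalarTower (MvPolynomial ι k) A₀ K := .of_algebraMap_eq fun p => by
    rw [halg]
    exact (hv.1.algebraMap_aevalEquiv p).symm
  exact .comp (MvPolynomial ι k) A₀ K

/-- Formal étaleness identifies the differentials of `K` with the base change of those of the
polynomial ring, where derivations are freely prescribed on the variables. -/
theorem exists_derivation_of_isTranscendenceBasis {ι k K : Type*} [Field k] [CharZero k] [Field K]
    [Algebra k K] {v : ι → K} (hv : IsTranscendenceBasis k v) (g : ι → K) :
    ∃ D : Derivation k K K, ∀ i, D (v i) = g i := by
  let _ : Algebra (MvPolynomial ι k) K := (aeval (R := k) v).toRingHom.toAlgebra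
  have : IsScalarTower k (MvPolynomial ι k) K := .of_algebraMap_eq fun r => by
    simp [RingHom.algebraMap_toAlgebra]
  have := formallyEtale_of_isTranscendenceBasis hv rfl
  let L := KaehlerDifferential.tensorKaehlerEquivOfFormallyEtale k (MvPolynomial ι k) K
  let l : TensorProduct (MvPolynomial ι k) K (KaehlerDifferential k (MvPolynomial ι k)) →ₗ[K] K :=
    (LinearMap.liftBaseChange K (mkDerivation k g).liftKaehlerDifferential)
  refine ⟨(l ∘ₗ L.symm.toLinearMap).compDer (KaehlerDifferential.D k K), fun i => ?_⟩
  have hi : v i = algebraMap (MvPolynomial ι k) K (X i) := by simp [RingHom.algebraMap_toAlgebra]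
  have := KaehlerDifferential.tensorKaehlerEquivOfFormallyEtale_symm_D_algebraMap
    k (MvPolynomial ι k) K (X i)
  rw [hi]
  simp [L, this, l]

/-- Prescribed values on algebraically independent elements extend to a derivation. -/
theorem AlgebraicIndependent.exists_derivation {ι k K : Type*} [Field k] [CharZero k] [Field K]
    [Algebra k K] {c : ι → K} (hc : AlgebraicIndependent k c) (g : ι → K) :
    ∃ D : Derivation k K K, ∀ i, D (c i) = g i := by
  obtain ⟨s, hs, hcs⟩ := exists_isTranscendenceBasis_superset (R := k)
    ((algebraicIndependent_subtype_range hc.injective).2 hc)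
  -- The value 0 on the remaining basis elements is an arbitrary choice.
  obtain ⟨D, hD⟩ := exists_derivation_of_isTranscendenceBasis hcs
    fun x => Function.extend c g 0 (x : K)
  exact ⟨D, fun i => by simpa [hc.injective.extend_apply] using hD ⟨c i, hs ⟨i, rfl⟩⟩⟩

/-! ### From generic to general parameters, and the two genericity conditions. -/

/-- If a polynomial system in parameters `σ` and unknowns `τ` has no solution over any extension
field of `ℂ` for algebraically independent parameters, then it has no complex solution for general
parameters. -/
theorem holdsForGeneral_of_generic {σ τ : Type} (S : Set (MvPolynomial (σ ⊕ τ) ℂ))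
    (h : ∀ (K : Type) [Field K] [Algebra ℂ K] (c : σ → K) (y : τ → K),
      AlgebraicIndependent ℂ c → ¬ ∀ p ∈ S, aeval (Sum.elim c y) p = 0) :
    HoldsForGeneral fun c : σ → ℂ => ∀ y : τ → ℂ, ¬ ∀ p ∈ S, aeval (Sum.elim c y) p = 0 := by
  let ι : MvPolynomial σ ℂ →ₐ[ℂ] MvPolynomial (σ ⊕ τ) ℂ := rename Sum.inl
  -- A nonzero element of the elimination ideal vanishes at every parameter admitting a solution. If
  -- there is none, a prime over `S` avoiding the nonzero parameter polynomials yields a solution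
  -- with independent parameters in its residue field.
  by_cases hI : ∃ p : MvPolynomial σ ℂ, p ≠ 0 ∧ ι p ∈ Ideal.span S
  · obtain ⟨p, hp, hpI⟩ := hI
    refine holdsForGeneral_iff.2 ⟨p, hp, fun c hc y hy => hc ?_⟩
    have hle : Ideal.span S ≤ RingHom.ker (aeval (R := ℂ) (Sum.elim c y)) :=
      Ideal.span_le.2 fun q hq => hy q hq
    have := hle hpI
    rw [RingHom.mem_ker, aeval_rename, Sum.elim_comp_inl] at this
    simpa [coe_aeval_eq_eval] using this
  · exfalso
    push Not at hI
    have hd : Disjoint (Ideal.span S : Set (MvPolynomial (σ ⊕ τ) ℂ))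
        ((nonZeroDivisors (MvPolynomial σ ℂ)).map ι) := by
      rw [Set.disjoint_right]
      rintro _ ⟨p, hp, rfl⟩
      exact hI p (nonZeroDivisors.ne_zero hp)
    obtain ⟨Q, hQ, hSQ, hdQ⟩ := Ideal.exists_le_prime_disjoint _ _ hd
    let φ : MvPolynomial (σ ⊕ τ) ℂ →ₐ[ℂ] FractionRing (MvPolynomial (σ ⊕ τ) ℂ ⧸ Q) :=
      (IsScalarTower.toAlgHom ℂ (MvPolynomial (σ ⊕ τ) ℂ ⧸ Q) _).comp (Ideal.Quotient.mkₐ ℂ Q)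
    have hφ : ∀ p, φ p = 0 ↔ p ∈ Q := fun p => by
      have := FaithfulSMul.algebraMap_eq_zero_iff (MvPolynomial (σ ⊕ τ) ℂ ⧸ Q)
        (FractionRing (MvPolynomial (σ ⊕ τ) ℂ ⧸ Q)) (r := Ideal.Quotient.mk Q p)
      rwa [Ideal.Quotient.eq_zero_iff_mem] at this
    have hφa : aeval (Sum.elim (fun a => φ (X (Sum.inl a))) fun b => φ (X (Sum.inr b))) = φ := by
      ext (a | b) <;> simp
    refine h _ (fun a => φ (X (Sum.inl a))) (fun b => φ (X (Sum.inr b))) ?_ fun p hp => ?_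
    · rw [algebraicIndependent_iff]
      intro p hp
      by_contra hp0
      refine Set.disjoint_right.1 hdQ ⟨p, mem_nonZeroDivisors_of_ne_zero hp0, rfl⟩ ?_
      rw [SetLike.mem_coe, ← hφ, ← hφa]
      simpa [ι, aeval_rename, Function.comp_def] using hp
    · rw [hφa, hφ]
      exact hSQ (Ideal.subset_span hp)

/-- The chain rule for a derivation that is trivial on the coefficients. -/
theorem derivation_aeval {σ k K : Type*} [Fintype σ] [CommRing k] [CommRing K] [Algebra k K]
    (D : Derivation k K K) (x : σ → K) (p : MvPolynomial σ k) :
    D (aeval x p) = ∑ i, aeval x (pderiv i p) * D (x i) := by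
  classical
  induction p using MvPolynomial.induction_on with
  | C a => simp
  | add p q hp hq => simp [hp, hq, add_mul, Finset.sum_add_distrib]
  | mul_X p i hp =>
    simp [hp, pderiv_X, Pi.single_apply, add_mul, Finset.sum_add_distrib, apply_ite (aeval x),
      Finset.mul_sum]
    exact Finset.sum_congr rfl fun j _ => by ring

/-- For general coefficients, a subsum of a sparse polynomial and a quadric `∑_{i ∈ J} x_i²` meet
transversally in the torus (if `J` is empty: the hypersurface of the subsum is smooth). -/
theorem holdsForGeneral_transverse {n : ℕ} (A : Finset (Fin n →₀ ℕ)) {F : Finset A}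
    (hF : F.Nonempty) (J : Finset (Fin n)) :
    HoldsForGeneral fun c : A → ℂ => ∀ (x : Fin n → ℂ) (t : ℂ), (∀ i, x i ≠ 0) →
      eval x (∑ a ∈ F, monomial (a : Fin n →₀ ℕ) (c a)) = 0 →
      (∀ i, eval x (pderiv i (∑ a ∈ F, monomial (a : Fin n →₀ ℕ) (c a))) =
        if i ∈ J then t * x i else 0) →
      ∑ i ∈ J, x i ^ 2 ≠ 0 := by
  classical
  let ix : Fin n → A ⊕ (Fin n ⊕ Fin n ⊕ Unit) := fun i => Sum.inr (Sum.inl i)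
  let iy : Fin n → A ⊕ (Fin n ⊕ Fin n ⊕ Unit) := fun i => Sum.inr (Sum.inr (Sum.inl i))
  let it : A ⊕ (Fin n ⊕ Fin n ⊕ Unit) := Sum.inr (Sum.inr (Sum.inr ()))
  let mon : A → MvPolynomial (Fin n) ℂ := fun a => monomial (a : Fin n →₀ ℕ) 1
  have hmon (a : A) (r : ℂ) : monomial (a : Fin n →₀ ℕ) r = C r * mon a := by
    simp [mon, C_mul_monomial]
  -- The unknowns `iy i` are inverses of the coordinates and encode the torus condition.
  let S : Set (MvPolynomial (A ⊕ (Fin n ⊕ Fin n ⊕ Unit)) ℂ) :=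
    {∑ a ∈ F, X (Sum.inl a) * rename ix (mon a), ∑ i ∈ J, X (ix i) ^ 2} ∪
    (Set.range fun i => ∑ a ∈ F, X (Sum.inl a) * rename ix (pderiv i (mon a)) -
      if i ∈ J then X it * X (ix i) else 0) ∪
    Set.range fun i => X (ix i) * X (iy i) - 1
  refine (holdsForGeneral_of_generic S ?_).mono fun c hc x t hx h₁ h₂ h₃ => ?_
  · intro K _ _ c y hc hS
    obtain ⟨x, hx⟩ : ∃ x : Fin n → K, Sum.elim c y ∘ ix = x := ⟨_, rfl⟩
    have hx' (i) : Sum.elim c y (ix i) = x i := congrFun hx i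
    have h₁ : ∑ a ∈ F, c a * aeval x (mon a) = 0 := by
      simpa [aeval_rename, hx] using hS _ (.inl (.inl (.inl rfl)))
    have h₃ : ∑ i ∈ J, x i ^ 2 = 0 := by
      simpa [hx'] using hS _ (.inl (.inl (.inr rfl)))
    have h₂ (i) : ∑ a ∈ F, c a * aeval x (pderiv i (mon a)) =
        if i ∈ J then Sum.elim c y it * x i else 0 := by
      have := hS _ (.inl (.inr ⟨i, rfl⟩))
      rw [map_sub, sub_eq_zero] at this
      simpa [aeval_rename, hx, hx', apply_ite (aeval (Sum.elim c y))] using this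
    have h₀ (i) : x i ≠ 0 := fun h0 => by
      have := hS _ (.inr ⟨i, rfl⟩)
      simp [hx', h0] at this
    obtain ⟨a₀, ha₀⟩ := hF
    -- Moving only the coefficient of `a₀`, differentiation of the subsum gives `x^{a₀} + t ∑_J x_i
    -- D x_i = 0`. The quadric kills the second term, so `x^{a₀} = 0`, impossible in the torus.
    obtain ⟨D, hD⟩ := AlgebraicIndependent.exists_derivation hc (Pi.single a₀ 1)
    have e₃ : ∑ i ∈ J, x i * D (x i) = 0 := by
      have := congrArg D h₃
      simp only [map_sum, Derivation.leibniz_pow, map_zero, pow_one, smul_eq_mul,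
        Nat.add_one_sub_one] at this
      have h2 : CharZero K := charZero_of_injective_algebraMap (algebraMap ℂ K).injective
      rw [← Finset.smul_sum] at this
      simpa using this
    have e₁ := congrArg D h₁
    simp only [map_sum, Derivation.leibniz, hD, derivation_aeval, map_zero, smul_eq_mul,
      Finset.sum_add_distrib, Finset.mul_sum] at e₁
    rw [Finset.sum_comm] at e₁
    simp only [← mul_assoc, ← Finset.sum_mul, h₂, ite_mul, zero_mul, Finset.sum_ite_mem,
      Finset.univ_inter] at e₁
    simp only [mul_assoc, ← Finset.mul_sum, e₃, mul_zero, zero_add, Pi.single_apply, mul_ite,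
      mul_one, Finset.sum_ite_eq', ha₀, if_true] at e₁
    refine Finset.prod_ne_zero_iff.2 (fun i _ => pow_ne_zero (a₀.1 i) (h₀ i)) (?_ : ∏ i, _ = (0 : K))
    simpa [mon, aeval_monomial, Finsupp.prod_fintype] using e₁
  · refine hc (Sum.elim x (Sum.elim x⁻¹ fun _ => t)) fun p hp => ?_
    have hx' (i) : Sum.elim c (Sum.elim x (Sum.elim x⁻¹ fun _ => t)) (ix i) = x i := rfl
    have hxc : Sum.elim c (Sum.elim x (Sum.elim x⁻¹ fun _ => t)) ∘ ix = x := rfl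
    simp only [hmon, map_sum, map_mul, eval_C, pderiv_C_mul] at h₁ h₂
    rcases hp with ((rfl | rfl) | ⟨i, rfl⟩) | ⟨i, rfl⟩
    · simpa [eval_rename, hxc] using h₁
    · simpa [hx'] using h₃
    · rw [map_sub, sub_eq_zero]
      simpa [eval_rename, hxc, hx', it, apply_ite (aeval (Sum.elim c _))] using h₂ i
    · simp [ix, iy, hx i]

/-- If `u` is algebraically independent, a critical point of the distance to `u` on `f = 0` does
not lie on a coordinate hyperplane, provided that `f` does not vanish at the origin. -/
theorem coord_ne_zero_of_algebraicIndependent {n : ℕ} {k K : Type*} [Field k] [CharZero k] [Field K]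
    [Algebra k K] {f : MvPolynomial (Fin n) k} (hf : eval 0 f ≠ 0) {u : Fin n → K}
    (hu : AlgebraicIndependent k u) {x : Fin n → K} {l : K} (hl : l ≠ 0)
    (hfx : aeval x f = 0) (hcrit : ∀ j, aeval x (pderiv j f) = l * (u j - x j)) (i : Fin n) :
    x i ≠ 0 := by
  classical
  intro hxi
  -- Otherwise `x` is `u` with its `i`-th entry set to zero. Independence of `u` then makes `f`
  -- vanish identically on that hyperplane, hence at the origin.
  obtain ⟨m, hmi, hm⟩ : ∃ m, m ≠ i ∧ aeval x (pderiv m f) ≠ 0 := by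
    by_contra! hall
    let g : MvPolynomial (Fin n) k := aeval (fun m => if m = i then 0 else X m) f
    have hg : aeval u g = 0 := by
      rw [← hfx, ← AlgHom.comp_apply]
      congr 1
      ext m
      by_cases hmi : m = i
      · simp [hmi, hxi]
      · have := hcrit m
        rw [hall m hmi, eq_comm, mul_eq_zero, or_iff_right hl, sub_eq_zero] at this
        simp [hmi, this]
    have hg0 : g = 0 := (algebraicIndependent_iff.1 hu) g hg
    apply hf
    have : aeval (0 : Fin n → k) g = 0 := by rw [hg0, map_zero]
    rw [← this, ← AlgHom.comp_apply, ← coe_aeval_eq_eval]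
    change aeval (0 : Fin n → k) f = _
    congr 1
    ext m
    by_cases hmi : m = i <;> simp [hmi]
  choose D hD using fun j => AlgebraicIndependent.exists_derivation hu (Pi.single j (1 : K))
  -- A dimension count: `T` sends a combination of the `D j` to its values on `(x, l)`. It is
  -- injective because `(x, l)` determines `u`. The relations `x i = 0` and `f(x) = 0` put its image
  -- in the kernel of `φ`, of dimension `n - 1`.
  let T : (Fin n → K) →ₗ[K] (Fin n → K) × K :=
    (LinearMap.pi fun m => ∑ j, (LinearMap.proj j).smulRight (D j (x m))).prod
      (∑ j, (LinearMap.proj j).smulRight (D j l))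
  have hsum (α : Fin n → K) (z : K) : (∑ j, α j • D j) z = ∑ j, α j * D j z := by
    have := congrFun (map_sum Derivation.coeFnAddMonoidHom (fun j => α j • D j) Finset.univ) z
    rwa [Finset.sum_apply] at this
  have hT (α) : T α = (fun m => (∑ j, α j • D j) (x m), (∑ j, α j • D j) l) := by
    ext <;> simp [T, hsum, LinearMap.sum_apply]
  let φ : (Fin n → K) × K →ₗ[K] K × K :=
    ((LinearMap.proj i).prod (∑ j, aeval x (pderiv j f) • LinearMap.proj j)) ∘ₗ
      LinearMap.fst K (Fin n → K) K
  have hφT : LinearMap.range T ≤ LinearMap.ker φ := by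
    rintro _ ⟨α, rfl⟩
    rw [LinearMap.mem_ker, hT]
    generalize ∑ j, α j • D j = E
    have := congrArg E hfx
    rw [derivation_aeval, map_zero] at this
    simp [φ, hxi, this]
  have hTinj : Function.Injective T := by
    rw [injective_iff_map_eq_zero]
    intro α hα
    rw [hT, Prod.mk_eq_zero] at hα
    have hE (j) : (∑ j, α j • D j) (u j) = α j := by
      simp [hsum, hD, Pi.single_apply]
    generalize ∑ j, α j • D j = E at hα hE
    obtain ⟨hEx, hEl⟩ := hα
    ext j
    have := congrArg E (hcrit j)
    have hEx' (m) : E (x m) = 0 := congrFun hEx m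
    simpa [derivation_aeval, hEx', hEl, hl, hE] using this
  have hφ : Function.Surjective φ := by
    rintro ⟨a, b⟩
    refine ⟨(Pi.single i a + Pi.single m
      ((aeval x (pderiv m f))⁻¹ * (b - aeval x (pderiv i f) * a)), 0), ?_⟩
    simp [φ, hmi.symm, mul_add, Finset.sum_add_distrib, Pi.single_apply, hm]
  have h₁ := LinearMap.finrank_range_of_inj hTinj
  have h₂ := Submodule.finrank_mono hφT
  have h₃ := LinearMap.finrank_range_add_finrank_ker φ
  rw [LinearMap.range_eq_top.2 hφ, finrank_top] at h₃
  simp only [Module.finrank_prod, Module.finrank_self, Module.finrank_fin_fun] at h₁ h₃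
  omega

theorem holdsForGeneral_coord_ne_zero {n : ℕ} {f : MvPolynomial (Fin n) ℂ} (hf : eval 0 f ≠ 0) :
    HoldsForGeneral fun u : Fin n → ℂ => ∀ (x : Fin n → ℂ) (l : ℂ), l ≠ 0 → eval x f = 0 →
      (∀ j, eval x (pderiv j f) = l * (u j - x j)) → ∀ i, x i ≠ 0 := by
  refine HoldsForGeneral.mono (HoldsForGeneral.forall fun i => ?_)
    fun u (h : ∀ i, ∀ (x : Fin n → ℂ) (l : ℂ), l ≠ 0 → eval x f = 0 →
      (∀ j, eval x (pderiv j f) = l * (u j - x j)) → x i ≠ 0) x l hl hx hc i => h i x l hl hx hc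
  let ix : Fin n → Fin n ⊕ (Fin n ⊕ Unit ⊕ Unit) := fun i => Sum.inr (Sum.inl i)
  let il : Fin n ⊕ (Fin n ⊕ Unit ⊕ Unit) := Sum.inr (Sum.inr (Sum.inl ()))
  let il' : Fin n ⊕ (Fin n ⊕ Unit ⊕ Unit) := Sum.inr (Sum.inr (Sum.inr ()))
  let S : Set (MvPolynomial (Fin n ⊕ (Fin n ⊕ Unit ⊕ Unit)) ℂ) :=
    -- The unknown `il'` is the inverse of the multiplier.
    {rename ix f, X il * X il' - 1, X (ix i)} ∪
    Set.range fun j => rename ix (pderiv j f) - X il * (X (Sum.inl j) - X (ix j))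
  refine (holdsForGeneral_of_generic S ?_).mono fun u hu x l hl hx hc hi => ?_
  · intro K _ _ u y hu hS
    have hl : Sum.elim u y il ≠ 0 := fun h0 => by
      have := hS _ (.inl (.inr (.inl rfl)))
      simp [h0] at this
    refine coord_ne_zero_of_algebraicIndependent hf hu (x := Sum.elim u y ∘ ix) hl ?_ ?_ i ?_
    · simpa [aeval_rename] using hS _ (.inl (.inl rfl))
    · intro j
      have := hS _ (.inr ⟨j, rfl⟩)
      rw [map_sub, sub_eq_zero] at this
      simpa [aeval_rename] using this
    · simpa using hS _ (.inl (.inr (.inr rfl)))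
  · refine hu (Sum.elim x (Sum.elim (fun _ => l) fun _ => l⁻¹)) fun p hp => ?_
    have hxc : Sum.elim u (Sum.elim x (Sum.elim (fun _ => l) fun _ => l⁻¹)) ∘ ix = x := rfl
    rcases hp with (rfl | rfl | rfl) | ⟨j, rfl⟩
    · simpa [aeval_rename, hxc, coe_aeval_eq_eval] using hx
    · simp [il, il', hl]
    · simpa [ix] using hi
    · rw [map_sub, sub_eq_zero]
      simpa [aeval_rename, hxc, coe_aeval_eq_eval, il, ix] using hc j

/-! ### Facial parts as weighted homogeneous components. -/

theorem weightAt_eq_weight {m : ℕ} (w : Fin m → ℤ) (a : Fin m →₀ ℕ) :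
    weightAt w a = Finsupp.weight w a := by
  simp [weightAt, Finsupp.weight_eq_sum, mul_comm]

/-- A lower bound for the weights whose component is nonzero is the minimum; this replaces faces by
linear projections. -/
theorem facialPart_eq_weightedHomogeneousComponent {n : ℕ} {w : Fin n → ℤ}
    {g : MvPolynomial (Fin n) ℂ} {m : ℤ} (hm : ∀ a ∈ g.support, m ≤ Finsupp.weight w a)
    (hne : weightedHomogeneousComponent w m g ≠ 0) :
    facialPart w g = weightedHomogeneousComponent w m g := by
  obtain ⟨b, hb⟩ := MvPolynomial.ne_zero_iff.1 hne
  rw [coeff_weightedHomogeneousComponent, ite_ne_right_iff, ← mem_support_iff] at hb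
  rw [facialPart, weightedHomogeneousComponent_apply, face]
  congr 1
  refine Finset.filter_congr fun a ha => ?_
  simp only [weightAt_eq_weight]
  refine ⟨fun h => le_antisymm ((h b hb.2).trans_eq hb.1) (hm a ha), fun h c hc => h ▸ hm c hc⟩

theorem weight_mapDomain_succ {n : ℕ} (w : Fin (n + 1) → ℤ) (a : Fin n →₀ ℕ) :
    Finsupp.weight w (a.mapDomain Fin.succ) = Finsupp.weight (fun i => w i.succ) a := by
  simp [Finsupp.weight_eq_sum, Fin.sum_univ_succ, Finsupp.mapDomain_apply (Fin.succ_injective n),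
    Finsupp.mapDomain_of_notMem_range]

theorem weightedHomogeneousComponent_monomial {σ R : Type*} [CommSemiring R] (w : σ → ℤ) (m : ℤ)
    (a : σ →₀ ℕ) (r : R) : weightedHomogeneousComponent w m (monomial a r) =
      if Finsupp.weight w a = m then monomial a r else 0 := by
  rw [weightedHomogeneousComponent_of_mem (isWeightedHomogeneous_monomial w a r rfl)]
  simp only [eq_comm]

theorem weightedHomogeneousComponent_rename_succ {n : ℕ} (w : Fin (n + 1) → ℤ) (m : ℤ)
    (p : MvPolynomial (Fin n) ℂ) : weightedHomogeneousComponent w m (rename Fin.succ p) =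
      rename Fin.succ (weightedHomogeneousComponent (fun i => w i.succ) m p) := by
  induction p using MvPolynomial.induction_on' with
  | add p q hp hq => simp only [map_add, hp, hq]
  | monomial a r =>
    rw [rename_monomial, weightedHomogeneousComponent_monomial,
      weightedHomogeneousComponent_monomial, weight_mapDomain_succ]
    split_ifs <;> simp [rename_monomial]

theorem le_weight_of_mem_support_rename_succ {n : ℕ} {w : Fin (n + 1) → ℤ} {m : ℤ}
    {p : MvPolynomial (Fin n) ℂ} (h : ∀ a ∈ p.support, m ≤ Finsupp.weight (fun i => w i.succ) a) :
    ∀ a ∈ (rename Fin.succ p).support, m ≤ Finsupp.weight w a := by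
  classical
  intro a ha
  rw [support_rename_of_injective (Fin.succ_injective n), Finset.mem_image] at ha
  obtain ⟨b, hb, rfl⟩ := ha
  rw [weight_mapDomain_succ]
  exact h b hb

theorem weightedHomogeneousComponent_pderiv {σ : Type*} (w : σ → ℤ) (m : ℤ) (i : σ)
    (p : MvPolynomial σ ℂ) : weightedHomogeneousComponent w m (pderiv i p) =
      pderiv i (weightedHomogeneousComponent w (m + w i) p) := by
  ext a
  simp only [coeff_weightedHomogeneousComponent, coeff_pderiv, map_add, Finsupp.weight_single,
    one_smul, add_left_inj, ite_mul, zero_mul]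

theorem le_weight_of_mem_support_pderiv {σ : Type*} {w : σ → ℤ} {m : ℤ}
    {p : MvPolynomial σ ℂ} (h : ∀ a ∈ p.support, m ≤ Finsupp.weight w a) (i : σ) :
    ∀ a ∈ (pderiv i p).support, m - w i ≤ Finsupp.weight w a := by
  intro a ha
  rw [mem_support_iff, coeff_pderiv] at ha
  have := h _ (mem_support_iff.2 (left_ne_zero_of_mul ha))
  simp only [map_add, Finsupp.weight_single, one_smul] at this
  linarith

theorem weightedHomogeneousComponent_eq_zero_of_lt {σ : Type*} {w : σ → ℤ} {m k : ℤ}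
    {p : MvPolynomial σ ℂ} (h : ∀ a ∈ p.support, k ≤ Finsupp.weight w a) (hm : m < k) :
    weightedHomogeneousComponent w m p = 0 :=
  weightedHomogeneousComponent_eq_zero' m p fun a ha => (hm.trans_le (h a ha)).ne'

/-- The facial part of an entry `P - λ (u - x_i)` of the Lagrange system, where `m` is the minimal
weight. -/
theorem eval_facialPart_sub_mul {n : ℕ} {w : Fin (n + 1) → ℤ} {P : MvPolynomial (Fin n) ℂ} {u : ℂ}
    (hu : u ≠ 0) {i : Fin n} {m : ℤ}
    (hP : ∀ a ∈ P.support, m ≤ Finsupp.weight (fun i => w i.succ) a) (h0 : m ≤ w 0)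
    (hi : m ≤ w 0 + w i.succ)
    (hne : weightedHomogeneousComponent (fun i => w i.succ) m P ≠ 0 ∨ w 0 = m ∨ w 0 + w i.succ = m)
    (z : Fin (n + 1) → ℂ) :
    eval z (facialPart w (rename Fin.succ P - X 0 * (C u - X i.succ))) =
      eval (fun i => z i.succ) (weightedHomogeneousComponent (fun i => w i.succ) m P) -
        z 0 * ((if w 0 = m then u else 0) - if w 0 + w i.succ = m then z i.succ else 0) := by
  classical
  have hC : (X 0 * C u : MvPolynomial (Fin (n + 1)) ℂ) = monomial (Finsupp.single 0 1) u := by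
    rw [mul_comm, C_mul_X_eq_monomial]
  have hX : (X 0 * X i.succ : MvPolynomial (Fin (n + 1)) ℂ) =
      monomial (Finsupp.single 0 1 + Finsupp.single i.succ 1) 1 := by
    simp [X, monomial_mul]
  have hw : weightedHomogeneousComponent w m (rename Fin.succ P - X 0 * (C u - X i.succ)) =
      rename Fin.succ (weightedHomogeneousComponent (fun i => w i.succ) m P) -
        X 0 * ((if w 0 = m then C u else 0) - if w 0 + w i.succ = m then X i.succ else 0) := by
    simp only [mul_sub, map_sub, weightedHomogeneousComponent_rename_succ, hC, hX,
      weightedHomogeneousComponent_monomial, map_add, Finsupp.weight_single, one_smul, mul_ite,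
      mul_zero]
  rw [facialPart_eq_weightedHomogeneousComponent (m := m), hw]
  · simp [eval_rename, Function.comp_def, apply_ite (eval z)]
  · intro a ha
    rw [mul_sub] at ha
    rcases Finset.mem_union.1 (support_sub _ _ _ ha) with ha | ha
    · exact le_weight_of_mem_support_rename_succ hP a ha
    · rcases Finset.mem_union.1 (support_sub _ _ _ ha) with ha | ha
      · rw [hC] at ha
        rw [Finset.mem_singleton.1 (support_monomial_subset ha)]
        simpa [Finsupp.weight_single] using h0
      · rw [hX] at ha
        rw [Finset.mem_singleton.1 (support_monomial_subset ha)]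
        simpa [Finsupp.weight_single] using hi
  · intro hzero
    rw [hw] at hzero
    -- Setting `λ = 0` isolates the part coming from `P`.
    have hPm : weightedHomogeneousComponent (fun i => w i.succ) m P = 0 := by
      have := congrArg (aeval (Fin.cons 0 X : Fin (n + 1) → MvPolynomial (Fin n) ℂ)) hzero
      rw [map_sub, aeval_rename] at this
      simpa [Function.comp_def] using this
    rw [hPm, map_zero, zero_sub, neg_eq_zero, mul_eq_zero, or_iff_right (X_ne_zero 0)] at hzero
    have h0m : w 0 ≠ m := fun h => hu <| by
      have := congrArg (eval 0) hzero
      rw [map_sub, apply_ite (eval 0), apply_ite (eval 0)] at this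
      simpa [h] using this
    rw [if_neg h0m, zero_sub, neg_eq_zero] at hzero
    have him : w 0 + w i.succ ≠ m := fun h => X_ne_zero (R := ℂ) i.succ (by rwa [if_pos h] at hzero)
    simp_all

/-- For nonnegative weights, the component of weight zero is the restriction to the coordinate
subspace of the variables of weight zero. -/
theorem eval_weightedHomogeneousComponent_zero {n : ℕ} {v : Fin n → ℤ} (hv : ∀ i, 0 ≤ v i)
    (x : Fin n → ℂ) (p : MvPolynomial (Fin n) ℂ) :
    eval x (weightedHomogeneousComponent v 0 p) =
      eval (fun i => if v i = 0 then x i else 0) p := by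
  induction p using MvPolynomial.induction_on' with
  | add p q hp hq => simp only [map_add, hp, hq]
  | monomial a r =>
    simp only [weightedHomogeneousComponent_monomial, Finsupp.weight_eq_sum,
      Finset.sum_eq_zero_iff_of_nonneg fun i _ => nsmul_nonneg (hv i) _, Finset.mem_univ,
      true_imp_iff, smul_eq_zero]
    split_ifs with h
    · rw [eval_monomial, eval_monomial, Finsupp.prod_fintype _ _ (by simp),
        Finsupp.prod_fintype _ _ (by simp)]
      congr 1
      refine Finset.prod_congr rfl fun i _ => ?_
      rcases h i with h | h <;> simp [h]
    · push Not at h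
      obtain ⟨i, hi, hvi⟩ := h
      rw [map_zero, eval_monomial, Finsupp.prod_fintype _ _ (by simp),
        Finset.prod_eq_zero (Finset.mem_univ i) (by simp [hi, hvi]), mul_zero]

/-- Weighted Euler formula, with weights that may be negative; it is checked on monomials. -/
theorem sum_intWeight_mul_eval_pderiv {n : ℕ} {v : Fin n → ℤ} {m : ℤ}
    {p : MvPolynomial (Fin n) ℂ} (hp : p.IsWeightedHomogeneous v m) (x : Fin n → ℂ) :
    ∑ i, (v i : ℂ) * (x i * eval x (pderiv i p)) = m * eval x p := by
  have hmon (i : Fin n) (a : Fin n →₀ ℕ) (r : ℂ) :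
      x i * eval x (pderiv i (monomial a r)) = a i * eval x (monomial a r) := by
    have := congrArg (eval x) (X_mul_pderiv_monomial (i := i) (m := a) (r := r))
    simpa using this
  rw [p.as_sum]
  simp only [map_sum, Finset.mul_sum, hmon]
  rw [Finset.sum_comm]
  refine Finset.sum_congr rfl fun a ha => ?_
  rw [← hp (mem_support_iff.1 ha), Finsupp.weight_eq_sum]
  push_cast
  rw [Finset.sum_mul]
  exact Finset.sum_congr rfl fun i _ => by simp; ring

/-! ### Sparse polynomials and the case analysis on the weight. -/

theorem coeff_sparsePoly {n : ℕ} {A : Finset (Fin n →₀ ℕ)} (c : A → ℂ) (a : A) :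
    coeff (a : Fin n →₀ ℕ) (sparsePoly A c) = c a := by
  classical
  simp [sparsePoly, coeff_sum, coeff_monomial]

theorem support_sparsePoly {n : ℕ} {A : Finset (Fin n →₀ ℕ)} {c : A → ℂ} (hc : ∀ a, c a ≠ 0) :
    (sparsePoly A c).support = A := by
  classical
  ext a
  by_cases ha : a ∈ A
  · simpa [ha, mem_support_iff] using (coeff_sparsePoly c ⟨a, ha⟩).trans_ne (hc _)
  · simp only [ha, iff_false, notMem_support_iff, sparsePoly, coeff_sum, coeff_monomial]
    exact Finset.sum_eq_zero fun b _ => if_neg fun h : (b : Fin n →₀ ℕ) = a => ha (h ▸ b.2)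

theorem weightedHomogeneousComponent_sparsePoly {n : ℕ} {A : Finset (Fin n →₀ ℕ)} (c : A → ℂ)
    (v : Fin n → ℤ) (m : ℤ) : weightedHomogeneousComponent v m (sparsePoly A c) =
      ∑ a ∈ Finset.univ.filter fun a : A => Finsupp.weight v (a : Fin n →₀ ℕ) = m,
        monomial (a : Fin n →₀ ℕ) (c a) := by
  simp [sparsePoly, weightedHomogeneousComponent_monomial, Finset.sum_filter]

theorem holdsForGeneral_ne_zero {σ : Type*} [Finite σ] :
    HoldsForGeneral fun x : σ → ℂ => ∀ i, x i ≠ 0 :=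
  HoldsForGeneral.forall fun i =>
    holdsForGeneral_iff.2 ⟨X i, X_ne_zero i, fun x hx => by simpa using hx⟩

theorem not_hasTorusSolution_facialSystem {n : ℕ} {A : Finset (Fin n →₀ ℕ)} (hA : 0 ∈ A)
    {c : A → ℂ} (hc : ∀ a, c a ≠ 0)
    (htrans : ∀ F : Finset A, F.Nonempty → ∀ (J : Finset (Fin n)) (x : Fin n → ℂ) (t : ℂ),
      (∀ i, x i ≠ 0) → eval x (∑ a ∈ F, monomial (a : Fin n →₀ ℕ) (c a)) = 0 →
      (∀ i, eval x (pderiv i (∑ a ∈ F, monomial (a : Fin n →₀ ℕ) (c a))) =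
        if i ∈ J then t * x i else 0) →
      ∑ i ∈ J, x i ^ 2 ≠ 0)
    {u : Fin n → ℂ} (hu : ∀ i, u i ≠ 0) (hfu : eval u (sparsePoly A c) ≠ 0)
    (hcrit : ∀ (x : Fin n → ℂ) (l : ℂ), l ≠ 0 → eval x (sparsePoly A c) = 0 →
      (∀ j, eval x (pderiv j (sparsePoly A c)) = l * (u j - x j)) → ∀ i, x i ≠ 0)
    {w : Fin (n + 1) → ℤ} (hw : w ≠ 0) :
    ¬ HasTorusSolution (facialSystem w (lagrange (sparsePoly A c) u)) := by
  classical
  rintro ⟨z, hz, hsol⟩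
  have hsupp := support_sparsePoly hc
  have hcomp := weightedHomogeneousComponent_sparsePoly c
  generalize sparsePoly A c = f at *
  obtain ⟨v, hv⟩ : ∃ v : Fin n → ℤ, v = fun i => w i.succ := ⟨_, rfl⟩
  have hv' (i) : w i.succ = v i := (congrFun hv i).symm
  obtain ⟨x, hx⟩ : ∃ x : Fin n → ℂ, x = fun i => z i.succ := ⟨_, rfl⟩
  have hx' (i) : z i.succ = x i := (congrFun hx i).symm
  have hx0 (i) : x i ≠ 0 := hx' i ▸ hz i.succ
  have hl := hz 0
  obtain ⟨a₀, ha₀, hmin⟩ := A.exists_min_image (Finsupp.weight v) ⟨0, hA⟩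
  obtain ⟨h, hh⟩ : ∃ h, h = Finsupp.weight v a₀ := ⟨_, rfl⟩
  have hf : ∀ a ∈ f.support, h ≤ Finsupp.weight v a := by
    rw [hsupp, hh]
    exact hmin
  have hF : (Finset.univ.filter fun a : A => Finsupp.weight v (a : Fin n →₀ ℕ) = h).Nonempty :=
    ⟨⟨a₀, ha₀⟩, by simp [hh]⟩
  have hfh : weightedHomogeneousComponent v h f ≠ 0 := fun h0 => by
    have := congrArg (coeff a₀) h0
    rw [coeff_weightedHomogeneousComponent, if_pos hh.symm, coeff_zero, ← notMem_support_iff,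
      hsupp] at this
    exact this ha₀
  have hfx : eval x (weightedHomogeneousComponent v h f) = 0 := by
    have := hsol 0
    rw [facialSystem, lagrange, Fin.cons_zero, facialPart_eq_weightedHomogeneousComponent (m := h),
      weightedHomogeneousComponent_rename_succ, ← hv, eval_rename] at this
    · rwa [hx]
    · exact le_weight_of_mem_support_rename_succ (hv ▸ hf)
    · rw [weightedHomogeneousComponent_rename_succ, ← hv]
      exact (map_ne_zero_iff _ (rename_injective _ (Fin.succ_injective n))).2 hfh
  have key (i : Fin n) (m : ℤ) (hP : ∀ a ∈ (pderiv i f).support, m ≤ Finsupp.weight v a)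
      (h0 : m ≤ w 0) (hi : m ≤ w 0 + v i)
      (hne : weightedHomogeneousComponent v m (pderiv i f) ≠ 0 ∨ w 0 = m ∨ w 0 + v i = m) :
      eval x (weightedHomogeneousComponent v m (pderiv i f)) =
        z 0 * ((if w 0 = m then u i else 0) - if w 0 + v i = m then x i else 0) := by
    have := hsol i.succ
    rw [facialSystem, lagrange, Fin.cons_succ, eval_facialPart_sub_mul (hu i) (m := m)
      (hv ▸ hP) h0 (by rwa [hv']) (by rwa [hv', ← hv]), sub_eq_zero] at this
    simpa only [← hv, ← hx, hv', hx'] using this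
  have hdf := le_weight_of_mem_support_pderiv hf
  rcases le_or_gt (w 0) h with hw0 | hw0
  -- If `v i < 0`, the term `λ x_i` alone has minimal weight in its entry, and it cannot vanish on
  -- the torus.
  · have hv0 (i) : 0 ≤ v i := by
      by_contra! hneg
      have := key i (w 0 + v i) (fun a ha => by linarith [hdf i a ha]) (by linarith) le_rfl
        (.inr (.inr rfl))
      rw [weightedHomogeneousComponent_eq_zero_of_lt (hdf i) (by linarith), map_zero,
        if_neg (by linarith), if_pos rfl, zero_sub, eq_comm] at this
      exact mul_ne_zero hl (neg_ne_zero.2 (hx0 i)) this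
    have hwt (a : Fin n →₀ ℕ) : 0 ≤ Finsupp.weight v a := by
      rw [Finsupp.weight_eq_sum]
      exact Finset.sum_nonneg fun i _ => nsmul_nonneg (hv0 i) _
    obtain rfl : h = 0 := le_antisymm (by simpa [hh] using hmin 0 hA) (hh ▸ hwt a₀)
    rw [eval_weightedHomogeneousComponent_zero hv0] at hfx
    rcases hw0.lt_or_eq with hw0 | hw0
    · have key' (i) := key i (w 0) (fun a _ => hw0.le.trans (hwt a)) le_rfl
        (by linarith [hv0 i]) (.inr (.inl rfl))
      have hcz (i) : weightedHomogeneousComponent v (w 0) (pderiv i f) = 0 :=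
        weightedHomogeneousComponent_eq_zero_of_lt (k := 0) (fun a _ => hwt a) hw0
      simp only [hcz, map_zero, if_true, add_eq_left, zero_eq_mul, hl, false_or, sub_eq_zero]
        at key'
      have hvz (i) : v i = 0 := by
        by_contra hvi
        exact hu i (by simpa [hvi] using key' i)
      refine hfu ?_
      have hxu : (fun i => if v i = 0 then x i else 0) = u := funext fun i => by
        simpa [hvz i, eq_comm] using key' i
      rwa [hxu] at hfx
    -- Here `w 0 = 0`, so `w ≠ 0` supplies a coordinate that the truncation of `x` sets to zero.
    · obtain ⟨i, hi⟩ : ∃ i, v i ≠ 0 := by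
        by_contra! hall
        exact hw (funext fun i => i.cases hw0 fun j => (hv' j).trans (hall j))
      refine hcrit _ (z 0) hl hfx (fun j => ?_) i (if_neg hi)
      rw [← eval_weightedHomogeneousComponent_zero hv0, key j 0 (fun a _ => hwt a) hw0.ge
        (by linarith [hv0 j]) (.inr (.inl hw0))]
      simp [hw0]
  · obtain ⟨J, hJ⟩ : ∃ J : Finset (Fin n), ∀ i, i ∈ J ↔
        pderiv i (weightedHomogeneousComponent v h f) ≠ 0 ∧ 2 * v i = h - w 0 :=
      ⟨Finset.univ.filter fun i =>
        pderiv i (weightedHomogeneousComponent v h f) ≠ 0 ∧ 2 * v i = h - w 0, fun i => by simp⟩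
    have hgrad (i) : eval x (pderiv i (weightedHomogeneousComponent v h f)) =
        if i ∈ J then -z 0 * x i else 0 := by
      by_cases hi : pderiv i (weightedHomogeneousComponent v h f) = 0
      · simp [hJ, hi]
      · have hq : weightedHomogeneousComponent v (h - v i) (pderiv i f) =
            pderiv i (weightedHomogeneousComponent v h f) := by
          rw [weightedHomogeneousComponent_pderiv, sub_add_cancel]
        -- When both bounds hold, `λ u_i` lies strictly above the minimum because `h < w 0`, and `λ
        -- x_i` attains it exactly when `2 v_i = h - w 0`. When one fails, `λ x_i` is again alone.
        by_cases hle : h - v i ≤ w 0 ∧ h - v i ≤ w 0 + v i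
        · have := key i (h - v i) (hdf i) hle.1 hle.2 (.inl (hq ▸ hi))
          rw [hq, if_neg (by omega)] at this
          rw [this]
          by_cases h2 : 2 * v i = h - w 0
          · rw [if_pos (by omega), if_pos ((hJ i).2 ⟨hi, h2⟩)]
            ring
          · rw [if_neg (by omega), if_neg fun hiJ => h2 ((hJ i).1 hiJ).2]
            ring
        · exfalso
          have := key i (w 0 + v i) (fun a ha => by have := hdf i a ha; omega) (by omega) le_rfl
            (.inr (.inr rfl))
          rw [weightedHomogeneousComponent_eq_zero_of_lt (hdf i) (by omega), map_zero,
            if_neg (by omega), if_pos rfl, zero_sub, eq_comm] at this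
          exact mul_ne_zero hl (neg_ne_zero.2 (hx0 i)) this
    have heuler := sum_intWeight_mul_eval_pderiv
      (weightedHomogeneousComponent_isWeightedHomogeneous (w := v) h f) x
    simp only [hfx, hgrad, mul_zero, mul_ite, Finset.sum_ite_mem, Finset.univ_inter] at heuler
    -- Twice Euler's formula, since `2 v_i = h - w 0` is constant on `J`.
    have hmul : ((h - w 0 : ℤ) : ℂ) * (-z 0) * ∑ i ∈ J, x i ^ 2 = 0 := by
      rw [Finset.mul_sum, ← mul_zero (2 : ℂ), ← heuler, Finset.mul_sum]
      refine Finset.sum_congr rfl fun i hi => ?_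
      rw [← ((hJ i).1 hi).2]
      push_cast
      ring
    have hne : ((h - w 0 : ℤ) : ℂ) ≠ 0 := Int.cast_ne_zero.2 (by omega)
    refine htrans _ hF J x (-z 0) hx0 (hcomp v h ▸ hfx) (hcomp v h ▸ hgrad) ?_
    exact (mul_eq_zero.1 hmul).resolve_left (mul_ne_zero hne (neg_ne_zero.2 hl))

end SparseED

open SparseED in
theorem theorem4p2 (n : ℕ) (A : Finset (Fin n →₀ ℕ)) (hA : 0 ∈ A) :
    SparseED.HoldsForGeneral fun c : A → ℂ =>
      (SparseED.sparsePoly A c).support = A ∧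
      SparseED.HoldsForGeneral fun u : Fin n → ℂ =>
        ∀ w : Fin (n + 1) → ℤ, w ≠ 0 →
          ¬ SparseED.HasTorusSolution
            (SparseED.facialSystem w (SparseED.lagrange (SparseED.sparsePoly A c) u)) := by
  have htrans := HoldsForGeneral.forall fun F : {F : Finset A // F.Nonempty} =>
    HoldsForGeneral.forall fun J : Finset (Fin n) => holdsForGeneral_transverse A F.2 J
  refine (holdsForGeneral_ne_zero.and htrans).mono fun c hc => ⟨support_sparsePoly hc.1, ?_⟩
  have hf0 : MvPolynomial.eval 0 (sparsePoly A c) ≠ 0 := by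
    rw [MvPolynomial.eval_zero, MvPolynomial.constantCoeff_eq]
    exact (coeff_sparsePoly c ⟨0, hA⟩).trans_ne (hc.1 _)
  have hfu : HoldsForGeneral fun u : Fin n → ℂ => MvPolynomial.eval u (sparsePoly A c) ≠ 0 :=
    holdsForGeneral_iff.2 ⟨_, fun h => hf0 (by rw [h, map_zero]), fun _ h => h⟩
  refine (holdsForGeneral_ne_zero.and (hfu.and (holdsForGeneral_coord_ne_zero hf0))).mono
    fun u hu w hw => not_hasTorusSolution_facialSystem hA hc.1
      (fun F hF J => hc.2 ⟨F, hF⟩ J) hu.1 hu.2.1 hu.2.2 hw
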